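/- Consider the ternary quadratic forms \[ \begin{aligned} Q_{2a}&=x^2+2y^2+5z^2+xz, & Q_{2b}&=x^2+3y^2+6z^2+xy+2yz, & Q_{2c}&=x^2+3y^2+7z^2+xy+xz,\\ Q_{5a}&=x^2+xz+2y^2+3yz+7z^2, & Q_{5b}&=x^2+2y^2+yz+7z^2, & Q_{23}&=x^2+2xz+2y^2+3yz+5z^2,\\ Q_{29}&=x^2+xz+2y^2+3yz+5z^2, & Q_{31}&=x^2+2xz+2y^2+yz+5z^2. & & \end{aligned} \] A form $Q$ represents an integer $N$ if $Q(x,y,z)=N$ for some $(x,y,z)\in\mathbb{Z}^3$. Let $N$ be a squarefree positive integer. \begin{enumerate} \item Suppose $N$ is coprime to $2$. If $N\equiv 0\pmod{19}$, then $Q_{2a}$ represents $N$; if $N\equiv 0\pmod{31}$, then $Q_{2b}$ represents $N$; if $N\equiv 0\pmod{37}$, then $Q_{2c}$ represents $N$. \item Suppose $N$ is coprime to $5$. If $N\equiv 0,2\pmod{3}$ or $N\equiv 3\pmod{4}$, then $Q_{5a}$ represents $N$; if $N\equiv 0\pmod{11}$ or $N\equiv 1\pmod{4}$, then $Q_{5b}$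 represents $N$. \item If $N$ is coprime to $23$ and $N\equiv 1\pmod{4}$, then $Q_{23}$ represents $N$. \item If $N$ is coprime to $29$ and $N\equiv 3\pmod{8}$, then $Q_{29}$ represents $N$. \item If $N$ is coprime to $31$ and $N\equiv 1\pmod{4}$, then $Q_{31}$ represents $N$. \end{enumerate} -/

import Mathlib

/-- The integral ternary quadratic form
`a x² + b y² + c z² + d x y + e x z + f y z` on `ℤ³`. -/
def ternaryForm (a b c d e f : ℤ) : QuadraticForm ℤ (Fin 3 → ℤ) :=
  a • QuadraticMap.proj 0 0 + b • QuadraticMap.proj 1 1 + c • QuadraticMap.proj 2 2 +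
    d • QuadraticMap.proj 0 1 + e • QuadraticMap.proj 0 2 + f • QuadraticMap.proj 1 2

theorem ternaryForm_apply (a b c d e f : ℤ) (v : Fin 3 → ℤ) :
    ternaryForm a b c d e f v =
      a * v 0 ^ 2 + b * v 1 ^ 2 + c * v 2 ^ 2 +
        d * v 0 * v 1 + e * v 0 * v 2 + f * v 1 * v 2 := by
  simp [ternaryForm]
  ring

/-- `Q` represents `n` if `Q v = n` for some integer vector `v`. -/
def Represents {r : ℕ} (Q : QuadraticForm ℤ (Fin r → ℤ)) (n : ℕ) : Prop :=
  ∃ v : Fin r → ℤ, Q v = (n : ℤ)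

/-- `x² + 2y² + 5z² + xz` -/
def Q2a : QuadraticForm ℤ (Fin 3 → ℤ) := ternaryForm 1 2 5 0 1 0

/-- `x² + 3y² + 6z² + xy + 2yz` -/
def Q2b : QuadraticForm ℤ (Fin 3 → ℤ) := ternaryForm 1 3 6 1 0 2

/-- `x² + 3y² + 7z² + xy + xz` -/
def Q2c : QuadraticForm ℤ (Fin 3 → ℤ) := ternaryForm 1 3 7 1 1 0

/-- `x² + xz + 2y² + 3yz + 7z²` -/
def Q5a : QuadraticForm ℤ (Fin 3 → ℤ) := ternaryForm 1 2 7 0 1 3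

/-- `x² + 2y² + yz + 7z²` -/
def Q5b : QuadraticForm ℤ (Fin 3 → ℤ) := ternaryForm 1 2 7 0 0 1

/-- `x² + 2xz + 2y² + 3yz + 5z²` -/
def Q23 : QuadraticForm ℤ (Fin 3 → ℤ) := ternaryForm 1 2 5 0 2 3

/-- `x² + xz + 2y² + 3yz + 5z²` -/
def Q29 : QuadraticForm ℤ (Fin 3 → ℤ) := ternaryForm 1 2 5 0 1 3

/-- `x² + 2xz + 2y² + yz + 5z²` -/
def Q31 : QuadraticForm ℤ (Fin 3 → ℤ) := ternaryForm 1 2 5 0 2 1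

/-! Let `D` be one of 2, 5, 23, 29, 31. Dirichlet's theorem and quadratic reciprocity yield, for
every `N` prime to `D`, some positive definite form of half-discriminant `D` with `N` as a
coefficient (`exists_admissible`). Minkowski reduction and the bound `abc ≤ D` leave finitely many
forms to consider.

For `D = 2, 5` these are all integrally equivalent. For `D = 23, 29, 31` they are not, but each is
rationally isometric to the target with 2-power denominators, and on vectors with the prescribed
value mod 4 or 8 one of finitely many such isometries is integral (`Rep.transfer_table`).

The remaining targets have half-discriminant `2p` with `p = 19, 31, 37`, or 45 or 55. Similitudes
and rational isometries link them to the single class of half-discriminant 2 or 5; for 45 and 55 a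
second form can appear, and the condition mod 4 moves it to the target. -/

/-- The coefficients of the form `a x² + b y² + c z² + d x y + e x z + f y z`. -/
structure Ternary where
  a : ℤ
  b : ℤ
  c : ℤ
  d : ℤ
  e : ℤ
  f : ℤ
deriving DecidableEq

/-! ### Ternary forms as coefficient tuples -/

namespace Ternary

/-- The value of the form at `(x, y, z)`. -/
def eval (Q : Ternary) (v : ℤ × ℤ × ℤ) : ℤ :=
  Q.a * v.1 ^ 2 + Q.b * v.2.1 ^ 2 + Q.c * v.2.2 ^ 2 +
    Q.d * v.1 * v.2.1 + Q.e * v.1 * v.2.2 + Q.f * v.2.1 * v.2.2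

/-- The half-discriminant, i.e. half the determinant of the Hessian matrix. -/
def disc (Q : Ternary) : ℤ :=
  4 * Q.a * Q.b * Q.c + Q.d * Q.e * Q.f - Q.a * Q.f ^ 2 - Q.b * Q.e ^ 2 - Q.c * Q.d ^ 2

/-- The form takes the value `n`. -/
def Rep (Q : Ternary) (n : ℤ) : Prop := ∃ v, Q.eval v = n

/-- The polar form. -/
def polar (Q : Ternary) (u v : ℤ × ℤ × ℤ) : ℤ :=
  2 * Q.a * u.1 * v.1 + 2 * Q.b * u.2.1 * v.2.1 + 2 * Q.c * u.2.2 * v.2.2 +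
    Q.d * (u.1 * v.2.1 + u.2.1 * v.1) + Q.e * (u.1 * v.2.2 + u.2.2 * v.1) +
    Q.f * (u.2.1 * v.2.2 + u.2.2 * v.2.1)

/-- The linear map whose matrix has columns `T.1`, `T.2.1`, `T.2.2`. -/
def lin (T : (ℤ × ℤ × ℤ) × (ℤ × ℤ × ℤ) × (ℤ × ℤ × ℤ)) (v : ℤ × ℤ × ℤ) : ℤ × ℤ × ℤ :=
  (v.1 * T.1.1 + v.2.1 * T.2.1.1 + v.2.2 * T.2.2.1,
   v.1 * T.1.2.1 + v.2.1 * T.2.1.2.1 + v.2.2 * T.2.2.2.1,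
   v.1 * T.1.2.2 + v.2.1 * T.2.1.2.2 + v.2.2 * T.2.2.2.2)

/-- The pull-back of a form along `lin T`. -/
def comap (Q : Ternary) (T : (ℤ × ℤ × ℤ) × (ℤ × ℤ × ℤ) × (ℤ × ℤ × ℤ)) : Ternary :=
  ⟨Q.eval T.1, Q.eval T.2.1, Q.eval T.2.2, Q.polar T.1 T.2.1, Q.polar T.1 T.2.2,
    Q.polar T.2.1 T.2.2⟩

/-- The form multiplied by a constant. -/
def scale (l : ℤ) (Q : Ternary) : Ternary :=
  ⟨l * Q.a, l * Q.b, l * Q.c, l * Q.d, l * Q.e, l * Q.f⟩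

theorem eval_comap (Q : Ternary) (T : (ℤ × ℤ × ℤ) × (ℤ × ℤ × ℤ) × (ℤ × ℤ × ℤ))
    (v : ℤ × ℤ × ℤ) : (Q.comap T).eval v = Q.eval (lin T v) := by
  simp only [eval, comap, lin, polar]; ring

theorem eval_scale (l : ℤ) (Q : Ternary) (v : ℤ × ℤ × ℤ) :
    (scale l Q).eval v = l * Q.eval v := by
  simp only [eval, scale]; ring

theorem represents_iff (a b c d e f : ℤ) (n : ℕ) :
    Represents (ternaryForm a b c d e f) n ↔ (⟨a, b, c, d, e, f⟩ : Ternary).Rep n := by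
  constructor
  · rintro ⟨v, hv⟩
    exact ⟨(v 0, v 1, v 2), by rw [← hv, ternaryForm_apply]; rfl⟩
  · rintro ⟨⟨x, y, z⟩, hv⟩
    exact ⟨![x, y, z], by rw [ternaryForm_apply, ← hv]; rfl⟩

/-! ### Rational isometries -/

/-- If every vector of `K` in the residue classes mod `M` where `P` holds is carried into `mℤ³` by
one of the similitudes in `L`, then a value `n` of `K` with `P (n % M)` gives, after rescaling, a
value of a target form. -/
theorem Rep.transfer {K : Ternary} {l m M : ℕ} {P : ℤ → Prop}
    (L : List (Ternary × (ℤ × ℤ × ℤ) × (ℤ × ℤ × ℤ) × (ℤ × ℤ × ℤ)))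
    (hM : 0 < M) (hmM : m ∣ M) (hL : ∀ p ∈ L, p.1.comap p.2 = scale l K)
    (hcov : ∀ x < M, ∀ y < M, ∀ z < M, P (K.eval (x, y, z) % M) →
      ∃ p ∈ L, (lin p.2 (x, y, z)).1 % m = 0 ∧ (lin p.2 (x, y, z)).2.1 % m = 0 ∧
        (lin p.2 (x, y, z)).2.2 % m = 0)
    {n k : ℤ} (hn : K.Rep n) (hP : P (n % M)) (hk : l * n = m ^ 2 * k) :
    ∃ p ∈ L, p.1.Rep k := by
  obtain ⟨⟨X, Y, Z⟩, hv⟩ := hn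
  have hres : ∀ X : ℤ, ∃ x < M, (x : ℤ) ≡ X [ZMOD M] := fun X => by
    have h0 : 0 ≤ X % M := Int.emod_nonneg _ (by positivity)
    have h1 : X % M < M := Int.emod_lt_of_pos _ (by positivity)
    exact ⟨(X % M).toNat, by omega, by rw [Int.toNat_of_nonneg h0]; exact Int.mod_modEq X M⟩
  obtain ⟨x, hx, hxX⟩ := hres X
  obtain ⟨y, hy, hyY⟩ := hres Y
  obtain ⟨z, hz, hzZ⟩ := hres Z
  have hKv : K.eval (x, y, z) ≡ n [ZMOD M] := by
    rw [← hv]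
    simp only [eval]
    gcongr
  obtain ⟨p, hp, h1, h2, h3⟩ := hcov x hx y hy z hz (by rwa [hKv.eq])
  refine ⟨p, hp, ?_⟩
  have hmM' : (m : ℤ) ∣ M := by exact_mod_cast hmM
  have hxX := hxX.of_dvd hmM'
  have hyY := hyY.of_dvd hmM'
  have hzZ := hzZ.of_dvd hmM'
  have hdvd : ∀ r s t : ℤ, (x * r + y * s + z * t) % m = 0 → (m : ℤ) ∣ X * r + Y * s + Z * t := by
    intro r s t h
    refine Int.dvd_of_emod_eq_zero (Eq.trans (Int.ModEq.symm ?_) h)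
    gcongr
  obtain ⟨u1, hu1⟩ := hdvd _ _ _ h1
  obtain ⟨u2, hu2⟩ := hdvd _ _ _ h2
  obtain ⟨u3, hu3⟩ := hdvd _ _ _ h3
  refine ⟨(u1, u2, u3), ?_⟩
  have hm : (m : ℤ) ^ 2 ≠ 0 := by
    have := Nat.pos_of_dvd_of_pos hmM hM
    positivity
  apply mul_left_cancel₀ hm
  rw [← hk, ← hv, ← eval_scale l, ← hL p hp, eval_comap]
  have : lin p.2 (X, Y, Z) = (m * u1, m * u2, m * u3) := by
    rw [← hu1, ← hu2, ← hu3]; rfl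
  rw [this]
  simp only [eval]
  ring

/-- The version of `Rep.transfer` for a table of forms `K`, each with its list of similitudes into
one fixed form `Q`. -/
theorem Rep.transfer_table {Q : Ternary} {l m M : ℕ} {P : ℤ → Prop}
    (tbl : List (Ternary × List ((ℤ × ℤ × ℤ) × (ℤ × ℤ × ℤ) × (ℤ × ℤ × ℤ))))
    (hM : 0 < M) (hmM : m ∣ M) (hL : ∀ t ∈ tbl, ∀ T ∈ t.2, Q.comap T = scale l t.1)
    (hcov : ∀ t ∈ tbl, ∀ x < M, ∀ y < M, ∀ z < M, P (t.1.eval (x, y, z) % M) →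
      ∃ T ∈ t.2, (lin T (x, y, z)).1 % m = 0 ∧ (lin T (x, y, z)).2.1 % m = 0 ∧
        (lin T (x, y, z)).2.2 % m = 0)
    {K : Ternary} (hK : K ∈ tbl.map Prod.fst) {n k : ℤ} (hn : K.Rep n) (hP : P (n % M))
    (hk : l * n = m ^ 2 * k) : Q.Rep k := by
  obtain ⟨t, ht, rfl⟩ := List.mem_map.1 hK
  obtain ⟨p, hp, hrep⟩ := hn.transfer (t.2.map (Prod.mk Q)) hM hmM
    (fun p hp => by obtain ⟨T, hT, rfl⟩ := List.mem_map.1 hp; exact hL t ht T hT)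
    (fun x hx y hy z hz h => by
      obtain ⟨T, hT, hdvd⟩ := hcov t ht x hx y hy z hz h
      exact ⟨_, List.mem_map_of_mem hT, hdvd⟩) hP hk
  obtain ⟨T, -, rfl⟩ := List.mem_map.1 hp
  exact hrep

/-! ### Reduction -/

/-- Positive definiteness. -/
def PosDef (Q : Ternary) : Prop := ∀ v ≠ 0, 0 < Q.eval v

/-- The positive definite forms of half-discriminant `D` that represent `n`. -/
def Admissible (D n : ℤ) (Q : Ternary) : Prop := Q.PosDef ∧ Q.disc = D ∧ Q.Rep n

/-- The determinant of the matrix with columns `T.1`, `T.2.1`, `T.2.2`. -/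
def det (T : (ℤ × ℤ × ℤ) × (ℤ × ℤ × ℤ) × (ℤ × ℤ × ℤ)) : ℤ :=
  T.1.1 * (T.2.1.2.1 * T.2.2.2.2 - T.2.1.2.2 * T.2.2.2.1) -
    T.1.2.1 * (T.2.1.1 * T.2.2.2.2 - T.2.1.2.2 * T.2.2.1) +
    T.1.2.2 * (T.2.1.1 * T.2.2.2.1 - T.2.1.2.1 * T.2.2.1)

theorem disc_comap (Q : Ternary) (T : (ℤ × ℤ × ℤ) × (ℤ × ℤ × ℤ) × (ℤ × ℤ × ℤ)) :
    (Q.comap T).disc = det T ^ 2 * Q.disc := by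
  obtain ⟨⟨_, _, _⟩, ⟨_, _, _⟩, ⟨_, _, _⟩⟩ := T
  simp only [disc, comap, det, eval, polar]
  ring

theorem Admissible.comap {D n : ℤ} {Q : Ternary} (h : Q.Admissible D n)
    (T S : (ℤ × ℤ × ℤ) × (ℤ × ℤ × ℤ) × (ℤ × ℤ × ℤ)) (hT : det T ^ 2 = 1)
    (hST : ∀ v, lin S (lin T v) = v) (hTS : ∀ v, lin T (lin S v) = v) :
    (Q.comap T).Admissible D n := by
  obtain ⟨hpos, hdisc, v, hv⟩ := h
  refine ⟨fun w hw => ?_, by rw [disc_comap, hT, one_mul, hdisc], lin S v, ?_⟩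
  · rw [eval_comap]
    refine hpos _ fun h0 => hw ?_
    rw [← hST w, h0]
    simp [lin]
  · rw [eval_comap, hTS, hv]

/-- An admissible form with the least possible trace. -/
def Minimal (D n : ℤ) (Q : Ternary) : Prop :=
  Q.Admissible D n ∧ ∀ Q' : Ternary, Q'.Admissible D n → Q.a + Q.b + Q.c ≤ Q'.a + Q'.b + Q'.c

theorem Admissible.pos {D n : ℤ} {Q : Ternary} (h : Q.Admissible D n) :
    0 < Q.a ∧ 0 < Q.b ∧ 0 < Q.c := by
  have h1 := h.1 (1, 0, 0) (by decide)
  have h2 := h.1 (0, 1, 0) (by decide)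
  have h3 := h.1 (0, 0, 1) (by decide)
  simp [eval] at h1 h2 h3
  exact ⟨h1, h2, h3⟩

theorem Admissible.exists_minimal {D n : ℤ} {Q : Ternary} (h : Q.Admissible D n) :
    ∃ Q' : Ternary, Q'.Minimal D n := by
  obtain ⟨Q', hQ', hmin⟩ := (measure fun Q : Ternary => (Q.a + Q.b + Q.c).toNat).wf.has_min
    {Q | Q.Admissible D n} ⟨Q, h⟩
  refine ⟨Q', hQ', fun R hR => ?_⟩
  have h1 : ¬ (R.a + R.b + R.c).toNat < (Q'.a + Q'.b + Q'.c).toNat := hmin R hR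
  have := hR.pos
  omega

theorem Minimal.comap {D n : ℤ} {Q : Ternary} (h : Q.Minimal D n)
    (T S : (ℤ × ℤ × ℤ) × (ℤ × ℤ × ℤ) × (ℤ × ℤ × ℤ)) (hT : det T ^ 2 = 1)
    (hST : ∀ v, lin S (lin T v) = v) (hTS : ∀ v, lin T (lin S v) = v)
    (htr : (Q.comap T).a + (Q.comap T).b + (Q.comap T).c ≤ Q.a + Q.b + Q.c) :
    (Q.comap T).Minimal D n :=
  ⟨h.1.comap T S hT hST hTS, fun Q' hQ' => htr.trans (h.2 Q' hQ')⟩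

theorem Minimal.swap_xy {D n : ℤ} {Q : Ternary} (h : Q.Minimal D n) :
    (⟨Q.b, Q.a, Q.c, Q.d, Q.f, Q.e⟩ : Ternary).Minimal D n := by
  convert h.comap ((0, 1, 0), (1, 0, 0), (0, 0, 1)) ((0, 1, 0), (1, 0, 0), (0, 0, 1)) (by decide)
    (by simp [lin]) (by simp [lin]) (by simp [Ternary.comap, eval, add_comm]) using 1
  simp [Ternary.comap, eval, polar]

theorem Minimal.swap_yz {D n : ℤ} {Q : Ternary} (h : Q.Minimal D n) :
    (⟨Q.a, Q.c, Q.b, Q.e, Q.d, Q.f⟩ : Ternary).Minimal D n := by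
  convert h.comap ((1, 0, 0), (0, 0, 1), (0, 1, 0)) ((1, 0, 0), (0, 0, 1), (0, 1, 0)) (by decide)
    (by simp [lin]) (by simp [lin]) (by simp [Ternary.comap, eval]; linarith) using 1
  simp [Ternary.comap, eval, polar]

theorem Minimal.neg_x {D n : ℤ} {Q : Ternary} (h : Q.Minimal D n) :
    (⟨Q.a, Q.b, Q.c, -Q.d, -Q.e, Q.f⟩ : Ternary).Minimal D n := by
  convert h.comap ((-1, 0, 0), (0, 1, 0), (0, 0, 1)) ((-1, 0, 0), (0, 1, 0), (0, 0, 1)) (by decide)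
    (by simp [lin]) (by simp [lin]) (by simp [Ternary.comap, eval]) using 1
  simp [Ternary.comap, eval, polar]

theorem Minimal.neg_y {D n : ℤ} {Q : Ternary} (h : Q.Minimal D n) :
    (⟨Q.a, Q.b, Q.c, -Q.d, Q.e, -Q.f⟩ : Ternary).Minimal D n := by
  simpa using h.swap_xy.neg_x.swap_xy

theorem Minimal.neg_z {D n : ℤ} {Q : Ternary} (h : Q.Minimal D n) :
    (⟨Q.a, Q.b, Q.c, Q.d, -Q.e, -Q.f⟩ : Ternary).Minimal D n := by
  simpa using h.neg_x.neg_y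

theorem Minimal.exists_sorted {D n : ℤ} {Q : Ternary} (h : Q.Minimal D n) :
    ∃ Q' : Ternary, Q'.Minimal D n ∧ Q'.a ≤ Q'.b ∧ Q'.b ≤ Q'.c := by
  rcases le_total Q.a Q.b with h1 | h1 <;> rcases le_total Q.b Q.c with h2 | h2 <;>
    rcases le_total Q.a Q.c with h3 | h3
  · exact ⟨_, h, h1, h2⟩
  · exact ⟨_, h, h1, h2⟩
  · exact ⟨_, h.swap_yz, h3, h2⟩
  · exact ⟨_, h.swap_yz.swap_xy, h3, h1⟩
  · exact ⟨_, h.swap_xy, h1, h3⟩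
  · exact ⟨_, h.swap_xy.swap_yz, h2, h3⟩
  · exact ⟨_, h.swap_xy.swap_yz.swap_xy, h2, h1⟩
  · exact ⟨_, h.swap_xy.swap_yz.swap_xy, h2, h1⟩

theorem Minimal.exists_signed {D n : ℤ} {Q : Ternary} (h : Q.Minimal D n) (hab : Q.a ≤ Q.b)
    (hbc : Q.b ≤ Q.c) : ∃ Q' : Ternary, Q'.Minimal D n ∧ Q'.a ≤ Q'.b ∧ Q'.b ≤ Q'.c ∧
      ((0 ≤ Q'.d ∧ 0 ≤ Q'.e ∧ 0 ≤ Q'.f) ∨ (Q'.d ≤ 0 ∧ Q'.e ≤ 0 ∧ Q'.f ≤ 0)) := by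
  rcases le_total 0 Q.d with h1 | h1 <;> rcases le_total 0 Q.e with h2 | h2 <;>
    rcases le_total 0 Q.f with h3 | h3
  · exact ⟨_, h, hab, hbc, Or.inl ⟨h1, h2, h3⟩⟩
  · exact ⟨_, h.neg_x, hab, hbc, Or.inr ⟨by simpa, by simpa, by simpa⟩⟩
  · exact ⟨_, h.neg_y, hab, hbc, Or.inr ⟨by simpa, by simpa, by simpa⟩⟩
  · exact ⟨_, h.neg_z, hab, hbc, Or.inl ⟨by simpa, by simpa, by simpa⟩⟩
  · exact ⟨_, h.neg_z, hab, hbc, Or.inr ⟨by simpa, by simpa, by simpa⟩⟩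
  · exact ⟨_, h.neg_y, hab, hbc, Or.inl ⟨by simpa, by simpa, by simpa⟩⟩
  · exact ⟨_, h.neg_x, hab, hbc, Or.inl ⟨by simpa, by simpa, by simpa⟩⟩
  · exact ⟨_, h, hab, hbc, Or.inr ⟨h1, h2, h3⟩⟩

/-- The shear changes only the coefficient `b`, so minimality of the trace bounds the change from
below. -/
theorem Minimal.shear_y {D n : ℤ} {Q : Ternary} (h : Q.Minimal D n) (t : ℤ) :
    0 ≤ Q.a * t ^ 2 + Q.d * t := by
  have := h.2 _ (h.1.comap ((1, 0, 0), (t, 1, 0), (0, 0, 1)) ((1, 0, 0), (-t, 1, 0), (0, 0, 1))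
    (by simp [det]) (by simp [lin]) (by simp [lin]))
  simp only [Ternary.comap, eval] at this
  linarith

theorem Minimal.shear_z {D n : ℤ} {Q : Ternary} (h : Q.Minimal D n) (s t : ℤ) :
    0 ≤ Q.a * s ^ 2 + Q.b * t ^ 2 + Q.d * s * t + Q.e * s + Q.f * t := by
  have := h.2 _ (h.1.comap ((1, 0, 0), (0, 1, 0), (s, t, 1)) ((1, 0, 0), (0, 1, 0), (-s, -t, 1))
    (by simp [det]) (by simp [lin]) (by simp [lin]))
  simp only [Ternary.comap, eval] at this
  linarith

/-- Minkowski-reduced forms with off-diagonal coefficients of equal sign. -/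
structure Reduced (Q : Ternary) : Prop where
  one_le : 1 ≤ Q.a
  ab : Q.a ≤ Q.b
  bc : Q.b ≤ Q.c
  sign : (0 ≤ Q.d ∧ Q.d ≤ Q.a ∧ 0 ≤ Q.e ∧ Q.e ≤ Q.a ∧ 0 ≤ Q.f ∧ Q.f ≤ Q.b) ∨
    (-Q.a ≤ Q.d ∧ Q.d ≤ 0 ∧ -Q.a ≤ Q.e ∧ Q.e ≤ 0 ∧ -Q.b ≤ Q.f ∧ Q.f ≤ 0 ∧
      0 ≤ Q.a + Q.b + Q.d + Q.e + Q.f)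

theorem Admissible.exists_reduced {D n : ℤ} {Q : Ternary} (h : Q.Admissible D n) :
    ∃ Q' : Ternary, Q'.Reduced ∧ Q'.disc = D ∧ Q'.Rep n := by
  obtain ⟨Q₁, hQ₁⟩ := h.exists_minimal
  obtain ⟨Q₂, hQ₂, hab, hbc⟩ := hQ₁.exists_sorted
  obtain ⟨R, hR, hab, hbc, hs⟩ := hQ₂.exists_signed hab hbc
  -- Steps `±1` give `|d| ≤ a`, `|e| ≤ a`, `|f| ≤ b`; the step `(1, 1)` gives the extra inequality
  -- of the non-positive case.
  have h1 := hR.shear_y 1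
  have h2 := hR.shear_y (-1)
  have h3 := hR.shear_z 1 0
  have h4 := hR.shear_z (-1) 0
  have h5 := hR.shear_z 0 1
  have h6 := hR.shear_z 0 (-1)
  have h7 := hR.shear_z 1 1
  refine ⟨R, ⟨by have := hR.1.pos; omega, hab, hbc, ?_⟩, hR.1.2.1, hR.1.2.2⟩
  norm_num at h1 h2 h3 h4 h5 h6 h7
  omega

/-- With non-negative signs each of `af²`, `be²`, `cd²` is at most `abc`. With non-positive signs
`def` counts against the bound, and the inequality on `a + b + d + e + f` compensates: the slack is
at least `a(c - b)(3b + d) + 2ab(b - a)`. -/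
theorem Reduced.mul_le_disc {Q : Ternary} (h : Q.Reduced) : Q.a * Q.b * Q.c ≤ Q.disc := by
  obtain ⟨a, b, c, d, e, f⟩ := Q
  obtain ⟨ha, hab, hbc, hs⟩ := h
  simp only [disc] at *
  have key : ∀ d e f : ℤ, 0 ≤ d → d ≤ a → 0 ≤ e → e ≤ a → 0 ≤ f → f ≤ b →
      a * f ^ 2 ≤ a * (b * f) ∧ b * e ^ 2 ≤ b * (a * e) ∧ c * d ^ 2 ≤ c * (a * d) := by
    intro d e f hd0 hd he0 he hf0 hf
    refine ⟨?_, ?_, ?_⟩ <;> rw [sq] <;> gcongr <;> omega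
  have ha0 : 0 ≤ a := by omega
  have hb0 : 0 ≤ b := by omega
  have hc0 : 0 ≤ c := by omega
  rcases hs with ⟨hd0, hd, he0, he, hf0, hf⟩ | ⟨hd, hd0, he, he0, hf, hf0, hsum⟩
  · obtain ⟨h1, h2, h3⟩ := key d e f hd0 hd he0 he hf0 hf
    have h4 : a * (b * f) ≤ a * (b * c) := by gcongr; omega
    have h5 : b * (a * e) ≤ b * (a * c) := by gcongr; omega
    have h6 : c * (a * d) ≤ c * (a * b) := by gcongr; omega
    have h7 : 0 ≤ d * e * f := by positivity
    linarith
  · obtain ⟨h1, h2, h3⟩ := key (-d) (-e) (-f) (by omega) (by omega) (by omega) (by omega)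
      (by omega) (by omega)
    have h4 : a * b * (-d - e - f) ≤ a * b * (a + b) := by gcongr; omega
    have h5 : -d * -e * -f ≤ a * a * b := by gcongr <;> omega
    have h6 : 0 ≤ a * ((c - b) * (3 * b + d)) :=
      mul_nonneg ha0 (mul_nonneg (by omega) (by omega))
    have h7 : a * b * a ≤ a * b * b := by gcongr
    linarith

/-! ### Enumeration of reduced forms -/

/-- A finite list that contains the reduced forms of half-discriminant `D`. -/
def candidates (D : ℕ) : List Ternary :=
  ((List.range (D + 1)).filter fun a => 0 < a ∧ a * a * a ≤ D).flatMap fun a : ℕ =>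
  ((List.range (D + 1)).filter fun b => a ≤ b ∧ a * b * b ≤ D).flatMap fun b : ℕ =>
  ((List.range (D + 1)).filter fun c => b ≤ c ∧ a * b * c ≤ D).flatMap fun c : ℕ =>
  (List.range (a + 1)).flatMap fun d : ℕ =>
  (List.range (a + 1)).flatMap fun e : ℕ =>
  (List.range (b + 1)).flatMap fun f : ℕ =>
    if d + e + f ≤ a + b then [⟨a, b, c, d, e, f⟩, ⟨a, b, c, -d, -e, -f⟩] else [⟨a, b, c, d, e, f⟩]

theorem Reduced.mem_candidates {D : ℕ} {Q : Ternary} (h : Q.Reduced) (hD : Q.disc = D) :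
    Q ∈ candidates D := by
  have hle := h.mul_le_disc
  rw [hD] at hle
  obtain ⟨a, b, c, d, e, f⟩ := Q
  obtain ⟨ha, hab, hbc, hs⟩ := h
  simp only at ha hab hbc hs hle
  lift a to ℕ using by omega
  lift b to ℕ using by omega
  lift c to ℕ using by omega
  norm_cast at ha hab hbc hle
  have h1 : a * b * b ≤ D := le_trans (by gcongr) hle
  have h2 : a * a * a ≤ D := le_trans (by gcongr) h1
  have hc : c ≤ D := le_trans (Nat.le_mul_of_pos_left c (Nat.mul_pos ha (by omega))) hle
  simp only [candidates, List.mem_flatMap, List.mem_filter, List.mem_range, decide_eq_true_eq]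
  refine ⟨a, ⟨by omega, ha, h2⟩, b, ⟨by omega, hab, h1⟩, c, ⟨by omega, hbc, hle⟩, ?_⟩
  rcases hs with ⟨hd0, hd, he0, he, hf0, hf⟩ | ⟨hd, hd0, he, he0, hf, hf0, hsum⟩
  · lift d to ℕ using hd0
    lift e to ℕ using he0
    lift f to ℕ using hf0
    refine ⟨d, by omega, e, by omega, f, by omega, ?_⟩
    split_ifs <;> simp
  · obtain ⟨d, rfl⟩ := Int.exists_eq_neg_ofNat hd0
    obtain ⟨e, rfl⟩ := Int.exists_eq_neg_ofNat he0
    obtain ⟨f, rfl⟩ := Int.exists_eq_neg_ofNat hf0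
    refine ⟨d, by omega, e, by omega, f, by omega, ?_⟩
    rw [if_pos (by omega)]
    simp

theorem Reduced.mem_of_disc {D : ℕ} {L : List Ternary}
    (hL : ∀ Q ∈ candidates D, Q.disc = D → Q ∈ L) {Q : Ternary} (h : Q.Reduced)
    (hD : Q.disc = D) : Q ∈ L :=
  hL Q (h.mem_candidates hD) hD

/-! ### Forms of given half-discriminant with `N` as a coefficient -/

/-- Completing squares, with denominators cleared, writes `4Nq` times the form as a positive
combination of three squares. -/
theorem posDef_of_corner {N b c f q D : ℤ} (hN : 0 < N) (hq : 0 < q) (hD : 0 < D)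
    (hb : q + 1 = 4 * N * b) (hc : N * f ^ 2 + D = q * c) :
    (⟨N, b, c, 1, 0, f⟩ : Ternary).PosDef := by
  rintro ⟨x, y, z⟩ hv
  have key : 4 * N * q * (⟨N, b, c, 1, 0, f⟩ : Ternary).eval (x, y, z) =
      q * (2 * N * x + y) ^ 2 + (q * y + 2 * N * f * z) ^ 2 + 4 * N * D * z ^ 2 := by
    simp only [eval]
    linear_combination (-q * y ^ 2) * hb - 4 * N * z ^ 2 * hc
  by_contra! h
  have hle : 4 * N * q * (⟨N, b, c, 1, 0, f⟩ : Ternary).eval (x, y, z) ≤ 0 :=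
    mul_nonpos_of_nonneg_of_nonpos (by positivity) h
  have h1 : 0 ≤ q * (2 * N * x + y) ^ 2 := by positivity
  have h2 : 0 ≤ (q * y + 2 * N * f * z) ^ 2 := by positivity
  have h3 : 0 ≤ 4 * N * D * z ^ 2 := by positivity
  have hz : z = 0 := by
    have : 4 * N * D * z ^ 2 = 0 := by linarith
    simpa [hN.ne', hD.ne'] using this
  subst hz
  have hy : y = 0 := by
    have : (q * y + 2 * N * f * 0) ^ 2 = 0 := by linarith
    simpa [hq.ne'] using this
  subst hy
  have hx : x = 0 := by
    have : q * (2 * N * x + 0) ^ 2 = 0 := by linarith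
    simpa [hN.ne', hq.ne'] using this
  exact hv (by rw [hx]; rfl)

/-- A positive integer `N` prime to `D` is represented by a positive definite form of
half-discriminant `D`, provided that `D` has Jacobi symbol `-1` for some `r ≡ 3 (mod 4)`. -/
theorem exists_admissible {D N : ℕ} (r : ℕ) (hD : 0 < D) (hN : 0 < N) (hcop : N.Coprime D)
    (hr : r % 4 = 3) (hJ : jacobiSym D r = -1) : ∃ Q : Ternary, Q.Admissible D N := by
  have hDr : Nat.Coprime r D := by
    by_contra h
    have := (jacobiSym.eq_zero_iff (a := D) (b := r)).2
      ⟨by omega, by rw [Int.gcd_natCast_natCast, Nat.gcd_comm]; exact h⟩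
    omega
  have hgcd : Nat.gcd (4 * N) (4 * D) = 4 := by
    rw [Nat.gcd_mul_left, hcop.gcd_eq_one]
  have hN4 : 4 * N - 1 + 1 = 4 * N := Nat.sub_add_cancel (by omega)
  -- The residues `-1` mod `4N` and `r` mod `4D` are compatible, both being 3 mod 4. Dirichlet then
  -- supplies a prime `q` in the combined class.
  obtain ⟨k, hk1, hk2⟩ := Nat.chineseRemainder' (n := 4 * N) (m := 4 * D) (a := 4 * N - 1) (b := r)
    (by rw [hgcd, Nat.ModEq]; omega)
  have hku : IsUnit (k : ZMod (4 * N * (4 * D))) := by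
    rw [ZMod.isUnit_iff_coprime]
    refine Nat.Coprime.mul_right ?_ ?_
    · rw [Nat.Coprime, hk1.gcd_eq]
      nth_rewrite 2 [← hN4]
      simp
    · rw [Nat.Coprime, hk2.gcd_eq]
      refine Nat.Coprime.mul_right ?_ hDr
      rw [Nat.Coprime, Nat.gcd_comm, Nat.gcd_rec, hr]
      rfl
  have : NeZero (4 * N * (4 * D)) := ⟨by positivity⟩
  obtain ⟨q, -, hq, hqk⟩ := Nat.forall_exists_prime_gt_and_eq_mod hku 0
  rw [ZMod.natCast_eq_natCast_iff] at hqk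
  have : Fact q.Prime := ⟨hq⟩
  have hqN : q ≡ 4 * N - 1 [MOD 4 * N] := (hqk.of_mul_right _).trans hk1
  have hqD : q ≡ r [MOD 4 * D] := (hqk.of_mul_left _).trans hk2
  have hq4 : q % 4 = 3 := by
    have : q ≡ r [MOD 4] := hqD.of_mul_right _
    rw [Nat.ModEq] at this; omega
  obtain ⟨b, hb⟩ : ∃ b, q + 1 = 4 * N * b := by
    have : q + 1 ≡ 4 * N - 1 + 1 [MOD 4 * N] := hqN.add_right 1
    rw [hN4] at this
    exact (Nat.modEq_zero_iff_dvd.1 (this.trans (by simp [Nat.ModEq])))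
  have hqodd : Odd q := Nat.odd_iff.2 (by omega)
  -- The symbol depends on `q` mod `4N` only, and `(N / 4N-1) = (4N / 4N-1) = (1 / 4N-1)`.
  have hJN : jacobiSym N q = 1 := by
    have hodd : Odd (4 * N - 1) := Nat.odd_iff.2 (by omega)
    rw [jacobiSym.mod_right' _ hqodd, hqN, ← jacobiSym.mod_right' _ hodd,
      ← one_mul (jacobiSym _ _), ← jacobiSym.at_four hodd, ← jacobiSym.mul_left,
      jacobiSym.at_four hodd, ← jacobiSym.one_left (4 * N - 1)]
    apply jacobiSym.mod_left'
    have : (4 * N : ℤ) = 1 + ((4 * N - 1 : ℕ) : ℤ) := by omega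
    rw [this, Int.add_emod_right]
  have hJD : jacobiSym D q = -1 := by
    rw [jacobiSym.mod_right' _ hqodd, hqD,
      ← jacobiSym.mod_right' _ (Nat.odd_iff.2 (by omega)), hJ]
  -- The signs of `(-1/q)` and `(D/q)` cancel.
  have hJDN : jacobiSym (-(D * N)) q = 1 := by
    rw [jacobiSym.neg _ hqodd, jacobiSym.mul_left, hJN, hJD, ZMod.χ₄_nat_three_mod_four hq4]
    rfl
  obtain ⟨s, hs⟩ := ZMod.isSquare_of_jacobiSym_eq_one hJDN
  have hNq : (N : ZMod q) ≠ 0 := by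
    rw [Ne, ZMod.natCast_eq_zero_iff]
    intro h
    have h1 : q ∣ q + 1 := by rw [hb, mul_right_comm]; exact h.mul_left _
    exact hq.one_lt.ne' (Nat.dvd_one.1 ((Nat.dvd_add_right dvd_rfl).1 h1))
  -- Take `f = s/N` mod `q` with `s² = -DN`. The half-discriminant is then `4Nbc - c - Nf² = qc -
  -- Nf² = D`.
  obtain ⟨c, hc⟩ : (q : ℤ) ∣ N * (((s * (N : ZMod q)⁻¹).val : ℕ) : ℤ) ^ 2 + D := by
    rw [← ZMod.intCast_zmod_eq_zero_iff_dvd]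
    push_cast at hs ⊢
    rw [ZMod.natCast_zmod_val]
    field_simp
    linear_combination -hs
  have hbz : (q : ℤ) + 1 = 4 * N * b := by exact_mod_cast hb
  refine ⟨_, posDef_of_corner (by exact_mod_cast hN) (by exact_mod_cast hq.pos)
    (by exact_mod_cast hD) hbz hc, ?_, (1, 0, 0), by simp [eval]⟩
  simp only [disc]
  linear_combination -hc - c * hbz

/-- The same, after reduction. -/
theorem exists_reduced_rep {D N : ℕ} (r : ℕ) (hD : 0 < D) (hN : 0 < N) (hcop : N.Coprime D)
    (hr : r % 4 = 3) (hJ : jacobiSym D r = -1) :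
    ∃ Q : Ternary, Q.Reduced ∧ Q.disc = D ∧ Q.Rep N :=
  (exists_admissible r hD hN hcop hr hJ).elim fun _ h => h.exists_reduced

/-! ### Half-discriminants 2, 5, 23, 29 and 31 -/

/-- Isometries of the reduced forms of half-discriminant `2` with one of them. -/
def disc2Table : List (Ternary × List ((ℤ × ℤ × ℤ) × (ℤ × ℤ × ℤ) × (ℤ × ℤ × ℤ))) := [
    (⟨1, 1, 1, 0, 1, 1⟩,
      [((1, -1, 0), (0, 0, 1), (1, 0, 0))]),
    (⟨1, 1, 1, 0, -1, -1⟩,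
      [((1, -1, 0), (0, 0, -1), (0, 1, 0))]),
    (⟨1, 1, 1, 1, 0, 1⟩,
      [((1, -1, 0), (1, 0, 0), (0, 0, 1))]),
    (⟨1, 1, 1, -1, 0, -1⟩,
      [((1, -1, 0), (-1, 0, 0), (0, 0, 1))]),
    (⟨1, 1, 1, 1, 1, 0⟩,
      [((1, 0, 0), (1, -1, 0), (0, 0, 1))]),
    (⟨1, 1, 1, -1, -1, 0⟩,
      [((0, -1, 0), (1, 0, 0), (0, 1, -1))]),
    (⟨1, 1, 1, 1, 1, 1⟩,
      [((1, 0, 0), (0, 0, 1), (0, 1, 0))])]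

/-- There is a single class; with `m = M = 1` the congruence and divisibility conditions are
vacuous. -/
theorem rep_disc2 {N : ℕ} (hN : 0 < N) (hcop : N.Coprime 2) : Rep ⟨1, 1, 1, 1, 1, 1⟩ N := by
  obtain ⟨K, hK, hD, hn⟩ := exists_reduced_rep (D := 2) 3 (by norm_num) hN hcop rfl (by norm_num)
  exact Rep.transfer_table (l := 1) (m := 1) (M := 1) (P := fun _ => True) disc2Table one_pos
    dvd_rfl (by decide +kernel) (by decide +kernel) (hK.mem_of_disc (by decide +kernel) hD) hn
    trivial (by push_cast; ring)

/-- Isometries of the reduced forms of half-discriminant `5` with one of them. -/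
def disc5Table : List (Ternary × List ((ℤ × ℤ × ℤ) × (ℤ × ℤ × ℤ) × (ℤ × ℤ × ℤ))) := [
    (⟨1, 1, 2, 1, 0, 1⟩,
      [((1, 0, 0), (0, 1, 0), (0, 0, 1))]),
    (⟨1, 1, 2, -1, 0, -1⟩,
      [((1, 0, 0), (0, -1, 0), (0, 0, 1))]),
    (⟨1, 1, 2, 1, 1, 0⟩,
      [((0, 1, 0), (1, 0, 0), (0, 0, 1))]),
    (⟨1, 1, 2, -1, -1, 0⟩,
      [((0, -1, 0), (1, 0, 0), (0, 0, 1))]),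
    (⟨1, 1, 2, 1, 1, 1⟩,
      [((1, 0, 0), (0, 1, 0), (0, 1, -1))])]

theorem rep_disc5 {N : ℕ} (hN : 0 < N) (hcop : N.Coprime 5) : Rep ⟨1, 1, 2, 1, 0, 1⟩ N := by
  obtain ⟨K, hK, hD, hn⟩ := exists_reduced_rep (D := 5) 3 (by norm_num) hN hcop rfl (by norm_num)
  exact Rep.transfer_table (l := 1) (m := 1) (M := 1) (P := fun _ => True) disc5Table one_pos
    dvd_rfl (by decide +kernel) (by decide +kernel) (hK.mem_of_disc (by decide +kernel) hD) hn
    trivial (by push_cast; ring)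

/-- For each reduced form of half-discriminant `23`, similitudes of ratio `4` into
`⟨1, 2, 5, 0, 2, 3⟩` that cover the vectors of value `1` modulo `4`. -/
def disc23Table : List (Ternary × List ((ℤ × ℤ × ℤ) × (ℤ × ℤ × ℤ) × (ℤ × ℤ × ℤ))) := [
    (⟨1, 1, 6, 0, 0, 1⟩,
      [((4, 0, 0), (-2, 0, 2), (2, 8, -2)),
       ((2, 0, -2), (-4, 0, 0), (1, 8, -3)),
       ((4, 0, 0), (2, 3, -2), (4, -2, -4))]),
    (⟨1, 1, 6, 0, 0, -1⟩,
      [((4, 0, 0), (2, 0, -2), (2, 8, -2)),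
       ((2, 0, -2), (4, 0, 0), (1, 8, -3)),
       ((4, 0, 0), (2, 3, -2), (-4, 2, 4))]),
    (⟨1, 1, 6, 0, 1, 0⟩,
      [((-2, 0, 2), (4, 0, 0), (2, 8, -2)),
       ((-4, 0, 0), (2, 0, -2), (1, 8, -3)),
       ((2, 3, -2), (4, 0, 0), (4, -2, -4))]),
    (⟨1, 1, 6, 0, -1, 0⟩,
      [((2, 0, -2), (4, 0, 0), (2, 8, -2)),
       ((4, 0, 0), (2, 0, -2), (1, 8, -3)),
       ((2, 3, -2), (4, 0, 0), (-4, 2, 4))]),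
    (⟨1, 1, 8, 1, 0, 1⟩,
      [((-4, 0, 0), (0, 2, -2), (0, 8, 0)),
       ((4, 2, -2), (4, 0, 0), (0, 6, 2)),
       ((-4, -2, 2), (0, -2, 2), (0, 6, 2))]),
    (⟨1, 1, 8, -1, 0, -1⟩,
      [((-4, 0, 0), (0, -2, 2), (0, 8, 0)),
       ((4, 2, -2), (-4, 0, 0), (0, 6, 2)),
       ((-4, -2, 2), (0, 2, -2), (0, 6, 2))]),
    (⟨1, 1, 8, 1, 1, 0⟩,
      [((0, 2, -2), (-4, 0, 0), (0, 8, 0)),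
       ((4, 0, 0), (4, 2, -2), (0, 6, 2)),
       ((0, -2, 2), (-4, -2, 2), (0, 6, 2))]),
    (⟨1, 1, 8, -1, -1, 0⟩,
      [((0, -2, 2), (-4, 0, 0), (0, 8, 0)),
       ((4, 0, 0), (0, 2, -2), (-4, 6, 2)),
       ((0, 2, -2), (-4, -2, 2), (0, 6, 2))]),
    (⟨1, 1, 8, 1, 1, 1⟩,
      [((0, -2, 2), (4, 0, 0), (0, 6, 2)),
       ((4, 0, 0), (0, -2, 2), (0, 6, 2)),
       ((0, -1, 2), (-4, -1, 2), (0, 8, 0))]),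
    (⟨1, 2, 3, 0, 0, 1⟩,
      [((4, 0, 0), (0, 4, 0), (4, 4, -4))]),
    (⟨1, 2, 3, 0, 0, -1⟩,
      [((4, 0, 0), (0, -4, 0), (4, 4, -4))])]

/-- The maps divided by 4 are rational isometries. A single map with all entries divisible by 4
marks a form integrally equivalent to the target; the other forms need the condition mod 4. -/
theorem rep_disc23 {N : ℕ} (hN : 0 < N) (hcop : N.Coprime 23) (hmod : N % 4 = 1) :
    Rep ⟨1, 2, 5, 0, 2, 3⟩ N := by
  obtain ⟨K, hK, hD, hn⟩ := exists_reduced_rep (D := 23) 3 (by norm_num) hN hcop rfl (by norm_num)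
  exact Rep.transfer_table (l := 16) (m := 4) (M := 4) (P := fun i => i = 1) disc23Table
    (by norm_num) dvd_rfl (by decide +kernel) (by decide +kernel)
    (hK.mem_of_disc (by decide +kernel) hD) hn (by omega) (by norm_num)

/-- For each reduced form of half-discriminant `29`, similitudes of ratio `8` into
`⟨1, 2, 5, 0, 1, 3⟩` that cover the vectors of value `3` modulo `8`. -/
def disc29Table : List (Ternary × List ((ℤ × ℤ × ℤ) × (ℤ × ℤ × ℤ) × (ℤ × ℤ × ℤ))) := [
    (⟨1, 1, 10, 1, 0, 1⟩,
      [((-2, 6, -2), (-6, 2, 2), (14, 6, 6)),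
       ((0, -4, 4), (4, 2, 2), (24, -4, -4)),
       ((2, -6, 2), (-4, -4, 4), (14, 6, 6))]),
    (⟨1, 1, 10, -1, 0, -1⟩,
      [((-2, 6, -2), (6, -2, -2), (14, 6, 6)),
       ((2, -6, 2), (4, 4, -4), (14, 6, 6)),
       ((0, -4, 4), (-4, -2, -2), (24, -4, -4))]),
    (⟨1, 1, 10, 1, 1, 0⟩,
      [((-6, 2, 2), (-2, 6, -2), (14, 6, 6)),
       ((4, 2, 2), (0, -4, 4), (24, -4, -4)),
       ((-4, -4, 4), (2, -6, 2), (14, 6, 6))]),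
    (⟨1, 1, 10, -1, -1, 0⟩,
      [((6, -2, -2), (-2, 6, -2), (14, 6, 6)),
       ((4, 4, -4), (2, -6, 2), (14, 6, 6)),
       ((-4, -2, -2), (0, -4, 4), (24, -4, -4))]),
    (⟨1, 1, 10, 1, 1, 1⟩,
      [((2, -6, 2), (6, -2, -2), (20, 4, 4)),
       ((-4, -4, 4), (-6, 2, 2), (14, 6, 6)),
       ((-6, 2, 2), (-4, -4, 4), (14, 6, 6))]),
    (⟨1, 2, 4, 0, 1, 1⟩,
      [((8, 0, 0), (0, -8, 0), (0, -8, 8))]),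
    (⟨1, 2, 4, 0, -1, -1⟩,
      [((8, 0, 0), (0, -8, 0), (0, 8, -8))]),
    (⟨1, 3, 3, 0, 1, 2⟩,
      [((0, -4, 4), (8, 8, 0), (-8, 4, 4)),
       ((0, -2, 4), (-8, 8, 0), (8, 8, 0)),
       ((-6, 2, 2), (-2, -10, 6), (5, 1, 5))]),
    (⟨1, 3, 3, 0, -1, -2⟩,
      [((0, -4, 4), (8, 8, 0), (8, -4, -4)),
       ((0, 2, -4), (8, -8, 0), (8, 8, 0)),
       ((6, -2, -2), (2, 10, -6), (5, 1, 5))]),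
    (⟨1, 3, 3, 1, 0, 2⟩,
      [((0, -4, 4), (-8, 4, 4), (8, 8, 0)),
       ((0, -2, 4), (8, 8, 0), (-8, 8, 0)),
       ((-6, 2, 2), (5, 1, 5), (-2, -10, 6))]),
    (⟨1, 3, 3, -1, 0, -2⟩,
      [((0, -4, 4), (8, -4, -4), (8, 8, 0)),
       ((0, 2, -4), (8, 8, 0), (8, -8, 0)),
       ((6, -2, -2), (5, 1, 5), (2, 10, -6))])]

theorem rep_disc29 {N : ℕ} (hN : 0 < N) (hcop : N.Coprime 29) (hmod : N % 8 = 3) :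
    Rep ⟨1, 2, 5, 0, 1, 3⟩ N := by
  obtain ⟨K, hK, hD, hn⟩ := exists_reduced_rep (D := 29) 3 (by norm_num) hN hcop rfl (by norm_num)
  exact Rep.transfer_table (l := 64) (m := 8) (M := 8) (P := fun i => i = 3) disc29Table
    (by norm_num) dvd_rfl (by decide +kernel) (by decide +kernel)
    (hK.mem_of_disc (by decide +kernel) hD) hn (by omega) (by norm_num)

/-- For each reduced form of half-discriminant `31`, similitudes of ratio `4` into
`⟨1, 2, 5, 0, 2, 1⟩` that cover the vectors of value `1` modulo `4`. -/
def disc31Table : List (Ternary × List ((ℤ × ℤ × ℤ) × (ℤ × ℤ × ℤ) × (ℤ × ℤ × ℤ))) := [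
    (⟨1, 1, 8, 0, 0, 1⟩,
      [((4, 0, 0), (-2, 0, 2), (0, 8, 0)),
       ((2, 0, -2), (-4, 0, 0), (-1, 8, -1)),
       ((4, 0, 0), (2, 0, -2), (2, 8, -2))]),
    (⟨1, 1, 8, 0, 0, -1⟩,
      [((4, 0, 0), (2, 0, -2), (0, 8, 0)),
       ((2, 0, -2), (4, 0, 0), (-1, 8, -1)),
       ((4, 0, 0), (-2, 0, 2), (2, 8, -2))]),
    (⟨1, 1, 8, 0, 1, 0⟩,
      [((-2, 0, 2), (4, 0, 0), (0, 8, 0)),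
       ((-4, 0, 0), (2, 0, -2), (-1, 8, -1)),
       ((2, 0, -2), (4, 0, 0), (2, 8, -2))]),
    (⟨1, 1, 8, 0, -1, 0⟩,
      [((2, 0, -2), (4, 0, 0), (0, 8, 0)),
       ((4, 0, 0), (2, 0, -2), (-1, 8, -1)),
       ((-2, 0, 2), (4, 0, 0), (2, 8, -2))]),
    (⟨1, 2, 4, 0, 0, 1⟩,
      [((4, 0, 0), (0, 4, 0), (-4, 0, 4))]),
    (⟨1, 2, 4, 0, 0, -1⟩,
      [((4, 0, 0), (0, 4, 0), (4, 0, -4))]),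
    (⟨1, 2, 5, 1, 0, 2⟩,
      [((4, 0, 0), (0, 2, 2), (-4, -4, 4)),
       ((2, 1, 1), (-4, 2, 2), (0, 6, -2)),
       ((2, 1, 1), (6, -1, -1), (0, -6, 2))]),
    (⟨1, 2, 5, -1, 0, -2⟩,
      [((-4, 0, 0), (0, 2, 2), (4, 4, -4)),
       ((2, 1, 1), (4, -2, -2), (0, 6, -2)),
       ((-2, -1, -1), (6, -1, -1), (0, 6, -2))]),
    (⟨1, 2, 5, -1, -1, -1⟩,
      [((4, 0, 0), (0, -2, -2), (0, 6, -2)),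
       ((4, -1, -1), (0, 2, 2), (0, 5, -3)),
       ((-4, 1, 1), (4, 1, 1), (4, 4, -4))]),
    (⟨1, 2, 5, 1, 1, 2⟩,
      [((4, 0, 0), (0, 2, 2), (4, 6, -2)),
       ((4, -1, -1), (4, 1, 1), (0, -5, 3)),
       ((4, -1, -1), (0, -2, -2), (4, 4, -4))])]

theorem rep_disc31 {N : ℕ} (hN : 0 < N) (hcop : N.Coprime 31) (hmod : N % 4 = 1) :
    Rep ⟨1, 2, 5, 0, 2, 1⟩ N := by
  -- Here `r = 3` fails, since 31 is a square mod 3; it is a non-residue mod 7.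
  obtain ⟨K, hK, hD, hn⟩ := exists_reduced_rep (D := 31) 7 (by norm_num) hN hcop rfl (by norm_num)
  exact Rep.transfer_table (l := 16) (m := 4) (M := 4) (P := fun i => i = 1) disc31Table
    (by norm_num) dvd_rfl (by decide +kernel) (by decide +kernel)
    (hK.mem_of_disc (by decide +kernel) hD) hn (by omega) (by norm_num)

/-! ### Multiples of 19, 31, 37 and 11 -/

/-- The half-discriminant is `38 = 2 · 19`, and the target restricted to a sublattice of index 19 is
19 times the form of half-discriminant 2. The next three lemmas work in the same way. -/
theorem rep_of_dvd_19 {N : ℕ} (hN : 0 < N) (hcop : N.Coprime 2) (h : 19 ∣ N) :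
    Rep ⟨1, 2, 5, 0, 1, 0⟩ N := by
  obtain ⟨k, rfl⟩ := h
  obtain ⟨v, hv⟩ := rep_disc2 (Nat.pos_of_mul_pos_left hN) hcop.coprime_mul_left
  refine ⟨lin ((3, -1, 1), (-1, 0, 2), (2, 2, 1)) v, ?_⟩
  rw [← eval_comap, show comap _ _ = scale 19 ⟨1, 1, 1, 1, 1, 1⟩ by decide, eval_scale, hv]
  push_cast; rfl

theorem rep_of_dvd_31 {N : ℕ} (hN : 0 < N) (hcop : N.Coprime 2) (h : 31 ∣ N) :
    Rep ⟨1, 3, 6, 1, 0, 2⟩ N := by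
  obtain ⟨k, rfl⟩ := h
  obtain ⟨v, hv⟩ := rep_disc2 (Nat.pos_of_mul_pos_left hN) hcop.coprime_mul_left
  refine ⟨lin ((5, 0, 1), (0, 1, 2), (1, 3, 0)) v, ?_⟩
  rw [← eval_comap, show comap _ _ = scale 31 ⟨1, 1, 1, 1, 1, 1⟩ by decide, eval_scale, hv]
  push_cast; rfl

theorem rep_of_dvd_37 {N : ℕ} (hN : 0 < N) (hcop : N.Coprime 2) (h : 37 ∣ N) :
    Rep ⟨1, 3, 7, 1, 1, 0⟩ N := by
  obtain ⟨k, rfl⟩ := h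
  obtain ⟨v, hv⟩ := rep_disc2 (Nat.pos_of_mul_pos_left hN) hcop.coprime_mul_left
  refine ⟨lin ((5, 0, 1), (-1, 2, 2), (2, 3, 0)) v, ?_⟩
  rw [← eval_comap, show comap _ _ = scale 37 ⟨1, 1, 1, 1, 1, 1⟩ by decide, eval_scale, hv]
  push_cast; rfl

theorem rep_of_dvd_11 {N : ℕ} (hN : 0 < N) (hcop : N.Coprime 5) (h : 11 ∣ N) :
    Rep ⟨1, 2, 7, 0, 0, 1⟩ N := by
  obtain ⟨k, rfl⟩ := h
  obtain ⟨v, hv⟩ := rep_disc5 (Nat.pos_of_mul_pos_left hN) hcop.coprime_mul_left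
  refine ⟨lin ((-1, 1, 1), (2, 0, 1), (0, -3, 1)) v, ?_⟩
  rw [← eval_comap, show comap _ _ = scale 11 ⟨1, 1, 2, 1, 0, 1⟩ by decide, eval_scale, hv]
  push_cast; rfl

/-! ### Half-discriminants 45 and 55 -/

/-- Since `45 = 9 · 5`, the target is rationally isometric to the form of half-discriminant 5. Six
isometries with denominators dividing 6 cover the vectors of value 0 or 2 mod 3. -/
theorem rep_disc45_of_mod_three {N : ℕ} (hN : 0 < N) (hcop : N.Coprime 5) (hmod : N % 3 ≠ 1) :
    Rep ⟨1, 2, 7, 0, 1, 3⟩ N := by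
  obtain ⟨p, hp, hrep⟩ := Rep.transfer (l := 36) (m := 6) (M := 6) (P := fun i => i % 3 ≠ 1)
    [
      (⟨1, 2, 7, 0, 1, 3⟩, ((6, 0, 0), (2, 0, 2), (0, 6, 0))),
      (⟨1, 2, 7, 0, 1, 3⟩, ((4, 0, -2), (-2, 0, -2), (-2, 6, -2))),
      (⟨1, 2, 7, 0, 1, 3⟩, ((2, 0, 2), (6, 0, 0), (4, 6, -2))),
      (⟨1, 2, 7, 0, 1, 3⟩, ((1, 3, 1), (-4, 0, 2), (1, -5, 3))),
      (⟨1, 2, 7, 0, 1, 3⟩, ((-4, 0, 2), (1, 3, 1), (6, -2, 2))),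
      (⟨1, 2, 7, 0, 1, 3⟩, ((5, 3, -1), (1, 3, 1), (3, -3, 3)))]
    (by norm_num) dvd_rfl (by decide +kernel) (by decide +kernel) (rep_disc5 hN hcop) (by omega)
    (show _ = _ * (_ : ℤ) by norm_num; rfl)
  simp only [List.mem_cons, List.not_mem_nil, or_false] at hp
  rcases hp with rfl | rfl | rfl | rfl | rfl | rfl <;> exact hrep

theorem rep_disc45_of_genus {n : ℤ} (hn : Rep ⟨2, 3, 3, -2, -1, -2⟩ n) (hmod : n % 4 = 3) :
    Rep ⟨1, 2, 7, 0, 1, 3⟩ n := by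
  obtain ⟨p, hp, hrep⟩ := Rep.transfer (l := 16) (m := 4) (M := 4) (P := fun i => i = 3)
    [
      (⟨1, 2, 7, 0, 1, 3⟩, ((-2, 2, -2), (4, -4, 0), (4, 4, 0))),
      (⟨1, 2, 7, 0, 1, 3⟩, ((4, 2, -2), (0, 2, 2), (2, -5, 1))),
      (⟨1, 2, 7, 0, 1, 3⟩, ((4, 1, -2), (-4, 4, 0), (4, -1, 2)))]
    (by norm_num) dvd_rfl (by decide +kernel) (by decide +kernel) hn (by omega)
    (show _ = _ * (_ : ℤ) by norm_num; rfl)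
  simp only [List.mem_cons, List.not_mem_nil, or_false] at hp
  rcases hp with rfl | rfl | rfl <;> exact hrep

/-- For `N ≡ 1` mod 3, isometries with denominator 3 reach either the target or a second form of
half-discriminant 45, which the condition mod 4 carries to the target. -/
theorem rep_disc45_of_mod_four {N : ℕ} (hN : 0 < N) (hcop : N.Coprime 5) (hmod : N % 4 = 3) :
    Rep ⟨1, 2, 7, 0, 1, 3⟩ N := by
  by_cases h3 : N % 3 = 1
  · obtain ⟨p, hp, hrep⟩ := Rep.transfer (l := 9) (m := 3) (M := 3) (P := fun i => i = 1)
      [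
      (⟨1, 2, 7, 0, 1, 3⟩, ((3, 0, 0), (1, 0, 1), (0, 3, 0))),
      (⟨1, 2, 7, 0, 1, 3⟩, ((2, 0, -1), (-1, 0, -1), (-1, 3, -1))),
      (⟨1, 2, 7, 0, 1, 3⟩, ((1, 0, 1), (3, 0, 0), (2, 3, -1))),
      (⟨2, 3, 3, -2, -1, -2⟩, ((-1, -1, -2), (1, 1, -1), (3, 0, 0))),
      (⟨2, 3, 3, -2, -1, -2⟩, ((-1, -1, 1), (1, 1, 2), (-1, 2, 1))),
      (⟨2, 3, 3, -2, -1, -2⟩, ((1, 1, -1), (2, 2, 1), (-1, 2, 1)))]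
      (by norm_num) dvd_rfl (by decide +kernel) (by decide +kernel) (rep_disc5 hN hcop) (by omega)
      (show _ = _ * (N : ℤ) by norm_num)
    simp only [List.mem_cons, List.not_mem_nil, or_false] at hp
    rcases hp with rfl | rfl | rfl | rfl | rfl | rfl
    · exact hrep
    · exact hrep
    · exact hrep
    · exact rep_disc45_of_genus hrep (by omega)
    · exact rep_disc45_of_genus hrep (by omega)
    · exact rep_disc45_of_genus hrep (by omega)
  · exact rep_disc45_of_mod_three hN hcop h3

theorem rep_disc55_of_genus {n : ℤ} (hn : Rep ⟨1, 2, 8, -1, 0, -1⟩ n) (hmod : n % 4 = 1) :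
    Rep ⟨1, 2, 7, 0, 0, 1⟩ n := by
  obtain ⟨p, hp, hrep⟩ := Rep.transfer (l := 16) (m := 4) (M := 4) (P := fun i => i = 1)
    [
      (⟨1, 2, 7, 0, 0, 1⟩, ((4, 0, 0), (-2, 0, -2), (0, 8, 0))),
      (⟨1, 2, 7, 0, 0, 1⟩, ((3, 0, -1), (2, 0, 2), (-1, 8, -1))),
      (⟨1, 2, 7, 0, 0, 1⟩, ((-3, 0, 1), (5, 0, 1), (-1, 8, -1)))]
    (by norm_num) dvd_rfl (by decide +kernel) (by decide +kernel) hn (by omega)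
    (show _ = _ * (_ : ℤ) by norm_num; rfl)
  simp only [List.mem_cons, List.not_mem_nil, or_false] at hp
  rcases hp with rfl | rfl | rfl <;> exact hrep

/-- A vector of value `11N` for the form of half-discriminant 5 is isotropic mod 11. Each similitude
of determinant `±11` kills one of the 12 isotropic lines mod 11; dividing the image by 11 gives
value `11 · 11N / 11² = N`, for the target or for a second form of half-discriminant 55. -/
theorem rep_disc55_of_mod_four {N : ℕ} (hN : 0 < N) (hcop : N.Coprime 5) (hmod : N % 4 = 1) :
    Rep ⟨1, 2, 7, 0, 0, 1⟩ N := by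
  obtain ⟨p, hp, hrep⟩ := Rep.transfer (l := 11) (m := 11) (M := 11) (P := fun i => i = 0)
    [
      (⟨1, 2, 7, 0, 0, 1⟩, ((-1, 1, 1), (2, 0, 1), (0, -3, 1))),
      (⟨1, 2, 7, 0, 0, 1⟩, ((1, 1, 1), (3, 1, 0), (0, 3, -1))),
      (⟨1, 2, 7, 0, 0, 1⟩, ((3, -1, 0), (2, 0, 1), (2, 3, 0))),
      (⟨1, 2, 7, 0, 0, 1⟩, ((3, 1, 0), (1, 1, 1), (-2, 3, 0))),
      (⟨1, 2, 7, 0, 0, 1⟩, ((-2, 0, 1), (1, 1, 1), (3, -2, 1))),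
      (⟨1, 2, 7, 0, 0, 1⟩, ((2, 0, 1), (3, -1, 0), (3, 2, -1))),
      (⟨1, 2, 8, -1, 0, -1⟩, ((0, -1, 1), (1, -2, 0), (5, 1, 0))),
      (⟨1, 2, 8, -1, 0, -1⟩, ((0, 1, -1), (1, -1, -1), (5, 1, 0))),
      (⟨1, 2, 8, -1, 0, -1⟩, ((2, 1, 1), (-1, -1, 1), (1, -3, 0))),
      (⟨1, 2, 8, -1, 0, -1⟩, ((1, -2, 0), (0, -1, 1), (4, 2, 1))),
      (⟨1, 2, 8, -1, 0, -1⟩, ((2, 1, 1), (3, 2, 0), (-1, 3, 0))),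
      (⟨1, 2, 8, -1, 0, -1⟩, ((-1, 2, 0), (-1, 1, 1), (4, 2, 1)))]
    (by norm_num) dvd_rfl (by decide +kernel) (by decide +kernel)
    (rep_disc5 (N := 11 * N) (by omega) (Nat.Coprime.mul_left (by norm_num) hcop)) (by omega)
    (show _ = _ * (N : ℤ) by push_cast; ring)
  simp only [List.mem_cons, List.not_mem_nil, or_false] at hp
  rcases hp with rfl | rfl | rfl | rfl | rfl | rfl | rfl | rfl | rfl | rfl | rfl | rfl
  · exact hrep
  · exact hrep
  · exact hrep
  · exact hrep
  · exact hrep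
  · exact hrep
  · exact rep_disc55_of_genus hrep (by omega)
  · exact rep_disc55_of_genus hrep (by omega)
  · exact rep_disc55_of_genus hrep (by omega)
  · exact rep_disc55_of_genus hrep (by omega)
  · exact rep_disc55_of_genus hrep (by omega)
  · exact rep_disc55_of_genus hrep (by omega)

end Ternary

theorem theorem1p7 (N : ℕ) (hpos : 0 < N) (hsf : Squarefree N) :
    (N.Coprime 2 →
      (N ≡ 0 [MOD 19] → Represents Q2a N) ∧
      (N ≡ 0 [MOD 31] → Represents Q2b N) ∧
      (N ≡ 0 [MOD 37] → Represents Q2c N)) ∧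
    (N.Coprime 5 →
      (N ≡ 0 [MOD 3] ∨ N ≡ 2 [MOD 3] ∨ N ≡ 3 [MOD 4] → Represents Q5a N) ∧
      (N ≡ 0 [MOD 11] ∨ N ≡ 1 [MOD 4] → Represents Q5b N)) ∧
    (N.Coprime 23 → N ≡ 1 [MOD 4] → Represents Q23 N) ∧
    (N.Coprime 29 → N ≡ 3 [MOD 8] → Represents Q29 N) ∧
    (N.Coprime 31 → N ≡ 1 [MOD 4] → Represents Q31 N) := by
  simp only [Q2a, Q2b, Q2c, Q5a, Q5b, Q23, Q29, Q31, Ternary.represents_iff, Nat.modEq_zero_iff_dvd]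
  refine ⟨fun hc => ⟨Ternary.rep_of_dvd_19 hpos hc, Ternary.rep_of_dvd_31 hpos hc,
    Ternary.rep_of_dvd_37 hpos hc⟩, fun hc => ⟨?_, ?_⟩, fun hc h => Ternary.rep_disc23 hpos hc h,
    fun hc h => Ternary.rep_disc29 hpos hc h, fun hc h => Ternary.rep_disc31 hpos hc h⟩
  · rintro (h | h | h)
    · exact Ternary.rep_disc45_of_mod_three hpos hc (by omega)
    · exact Ternary.rep_disc45_of_mod_three hpos hc (by rw [h]; decide)
    · exact Ternary.rep_disc45_of_mod_four hpos hc h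
  · rintro (h | h)
    · exact Ternary.rep_of_dvd_11 hpos hc h
    · exact Ternary.rep_disc55_of_mod_four hpos hc h
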